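/- Consider a two-player Blotto game on $n\ge 2$ battlefields, with budgets $T_A\ge T_B>0$ and symmetric battlefield values $v_{A,i}=v_{B,i}=v_i>0$, $\sum_{i=1}^n v_i=1$. A mixed strategy of player $P\in\{A,B\}$ is the law of a random vector $X_P=(X_{P,1},\dots,X_{P,n})$ with nonnegative entries; it is admissible in the Blotto game if $\sum_i X_{P,i}\le T_P$ almost surely, and in the associated Lotto game if $\sum_i \mathbb E[X_{P,i}]\le T_P$. Against an independent strategy of the opponent $\bar P$, player $P$ receives $v_i$ on each battlefield where $X_{P,i}>X_{\bar P,i}$, ties being broken by an arbitrary (measurable) rule that divides $v_i$ between the two players. A strategy of $P$ is optimal if it is admissible and maximizes, over all admissible strategies of $P$, the infimum of the expected reward of $P$ over all admissible strategies of $\bar P$. Let $\gamma^*=T_B/T_A$ and $\lambda^*=T_B/(2T_A^2)$, and consider the corresponding Lotto marginals, for $i=1,\dots,n$, $$X_{A,i}\sim \mathsf{Unif}\Big[0,\frac{\gamma^* v_i}{\lambda^*}\Big]=\mathsf{Unif}[0,2T_Av_i],\qquad X_{B,i}\sim (1-\gamma^*)\,\delta_0+\gamma^*\,\mathsf{Unif}\Big[0,\frac{\gamma^*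 v_i}{\lambda^*}\Big].$$ For each player, every coupling of these marginals is an optimal strategy of the Lotto game. Moreover, these marginals can be coupled, for both players $A$ and $B$, into optimal strategies of the Blotto game (that is, for each player $P$ there is a joint law with the prescribed marginals $X_{P,1},\dots,X_{P,n}$ that is an optimal Blotto strategy of $P$) if and only if $$\max_{1\le i\le n} v_i\le \frac{T_B}{2T_A}.$$ -/

import Mathlib

open MeasureTheory

namespace Blotto

/-- The two players. -/
inductive Player
  | A
  | B

/-- The opponent of a player. -/
def Player.other : Player → Player
  | .A => .B
  | .B => .A

/-- The datum of a two-player Blotto (or Lotto) game on `n ≥ 2` battlefields: positive budgets,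
player `A` being at least as rich as player `B`, and positive battlefield values which sum to `1`
for each player. -/
structure Game (n : ℕ) where
  budget : Player → ℝ
  value : Player → Fin n → ℝ
  two_le : 2 ≤ n
  budget_pos : ∀ P, 0 < budget P
  budget_le : budget .B ≤ budget .A
  value_pos : ∀ P i, 0 < value P i
  sum_value : ∀ P, ∑ i, value P i = 1

/-- A pure strategy allocates the amount `x i` to battlefield `i`. -/
abbrev Allocation (n : ℕ) : Type := Fin n → ℝ

/-- An arbitrary rule to break ties. If the players are tied on battlefield `i` under the
allocations `x` of `A` and `y` of `B`, then `A` gets the fraction (or probability)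
`share i x y` of the battlefield and `B` gets the rest. -/
structure TieRule (n : ℕ) where
  share : Fin n → Allocation n → Allocation n → ℝ
  share_nonneg : ∀ i x y, 0 ≤ share i x y
  share_le_one : ∀ i x y, share i x y ≤ 1
  measurable_share : ∀ i,
    Measurable (fun p : Allocation n × Allocation n => share i p.1 p.2)

/-- The fraction of a tied battlefield that goes to player `P`, who plays `x` against `y`. -/
def TieRule.shareOf {n : ℕ} (τ : TieRule n) : Player → Fin n → Allocation n → Allocation n → ℝ
  | .A, i, x, y => τ.share i x y
  | .B, i, x, y => 1 - τ.share i y x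

open Classical in
/-- The fraction of battlefield `i` won by player `P`, who plays `x` against `y`. -/
noncomputable def won {n : ℕ} (τ : TieRule n) (P : Player) (i : Fin n) (x y : Allocation n) : ℝ :=
  if y i < x i then 1 else if x i = y i then τ.shareOf P i x y else 0

/-- The expected reward of player `P`, who plays the mixed strategy `μ` while the opponent
independently plays the mixed strategy `ν`. -/
noncomputable def utility {n : ℕ} (G : Game n) (τ : TieRule n) (P : Player)
    (μ ν : Measure (Allocation n)) : ℝ :=
  ∫ p, ∑ i, G.value P i * won τ P i p.1 p.2 ∂(μ.prod ν)

/-- A mixed strategy is the law of a random allocation of nonnegative amounts. -/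
def IsMixedStrategy {n : ℕ} (μ : Measure (Allocation n)) : Prop :=
  IsProbabilityMeasure μ ∧ ∀ᵐ x ∂μ, ∀ i, 0 ≤ x i

/-- Admissible mixed strategies of the Blotto game: the budget holds almost surely. -/
def BlottoAdmissible {n : ℕ} (G : Game n) (P : Player) (μ : Measure (Allocation n)) : Prop :=
  IsMixedStrategy μ ∧ ∀ᵐ x ∂μ, ∑ i, x i ≤ G.budget P

/-- Admissible mixed strategies of the Lotto game: the budget holds in expectation. -/
def LottoAdmissible {n : ℕ} (G : Game n) (P : Player) (μ : Measure (Allocation n)) : Prop :=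
  IsMixedStrategy μ ∧ (∀ i, Integrable (fun x : Allocation n => x i) μ) ∧
    ∑ i, ∫ x, x i ∂μ ≤ G.budget P

/-- Player `P` secures the expected reward `c` by playing `μ`, when `admissible Q` is the set of
mixed strategies that player `Q` may play. -/
def Secures {n : ℕ} (G : Game n) (τ : TieRule n)
    (admissible : Player → Measure (Allocation n) → Prop) (P : Player)
    (μ : Measure (Allocation n)) (c : ℝ) : Prop :=
  ∀ ν, admissible P.other ν → c ≤ utility G τ P μ ν

/-- Optimal (maximin) strategies of player `P`: an admissible strategy that secures every expected
reward which some admissible strategy of `P` secures. In other words, `μ` maximizes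
`inf_ν utility G τ P μ ν`. -/
def IsOptimal {n : ℕ} (G : Game n) (τ : TieRule n)
    (admissible : Player → Measure (Allocation n) → Prop) (P : Player)
    (μ : Measure (Allocation n)) : Prop :=
  admissible P μ ∧
    ∀ μ', admissible P μ' → ∀ c, Secures G τ admissible P μ' c → Secures G τ admissible P μ c

/-- The uniform distribution on `[0, b]`, for `b > 0`. -/
noncomputable def unif (b : ℝ) : Measure ℝ := ProbabilityTheory.cond volume (Set.Icc 0 b)

/-- The mixture `(1 - p) δ₀ + p Unif[0, b]`. -/
noncomputable def zeroUnifMixture (p b : ℝ) : Measure ℝ :=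
  ENNReal.ofReal (1 - p) • Measure.dirac 0 + ENNReal.ofReal p • unif b

open Classical in
/-- The marginal distributions, with parameters `γ` and `lam`, of the Lotto strategies of the two
players. The condition `γ ≤ v_{A,i} / v_{B,i}` says that `i` belongs to `𝒩(γ)`. -/
noncomputable def lottoMarginal {n : ℕ} (G : Game n) (γ lam : ℝ) : Player → Fin n → Measure ℝ
  | .A, i =>
      if γ ≤ G.value .A i / G.value .B i then unif (γ * G.value .B i / lam)
      else zeroUnifMixture (G.value .A i / (γ * G.value .B i)) (G.value .A i / lam)
  | .B, i =>
      if γ ≤ G.value .A i / G.value .B i then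
        zeroUnifMixture (γ * G.value .B i / G.value .A i) (γ * G.value .B i / lam)
      else unif (G.value .A i / lam)

/-- `π` is a coupling of the distributions `m i`: its `i`-th marginal is `m i`. -/
def IsCoupling {n : ℕ} (π : Measure (Allocation n)) (m : Fin n → Measure ℝ) : Prop :=
  ∀ i, π.map (fun x => x i) = m i

end Blotto

/-! Optimality. A marginal `(1 - p) δ₀ + p Unif[0, a]` exceeds `t ≥ 0` with probability at least `p
(1 - t / a)`, which is affine in `t`. With `a = 2 T_A v_i` the values cancel when summed against the
`v_i`, so the reward secured depends on the opponent only through the expected total spending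
(`securedValue_le_utility`). Only strict wins are counted, so the tie rule plays no role. The two
secured values add up to the constant sum `1` of the game, hence both strategies are optimal. Blotto
strategies are Lotto strategies, so the same argument applies in the Blotto game once both players
have couplings that respect the budget almost surely.

Couplings. Since the mean total spending equals the budget `K = T_P`, a Blotto coupling is one with
constant sum `K`. It requires each interval length `2 T_A v_i` to be at most `K`, and player `B`
gives the binding condition. Conversely, `exists_coupling_sum_eq` builds the coupling when all
lengths are at most `K`. The core is the case of three distributions (`exists_three_coupling`),
solved by mixing uniform laws on nine segments in the plane `x + y + z = K`. Its consequence
`exists_two_coupling` merges two distributions into one of the same type, so the battlefields can be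
gathered into three groups. -/

namespace Blotto

/-! ### Uniform laws on segments and their mixtures -/

/-- The uniform distribution on the segment from `x` to `y` of a real vector space. -/
noncomputable def segmentLaw {E : Type*} [AddCommGroup E] [Module ℝ E] [MeasurableSpace E]
    (x y : E) : Measure E :=
  (volume.restrict (Set.Icc (0 : ℝ) 1)).map (fun u => x + u • (y - x))

lemma segmentLaw_comm (x y : ℝ) : segmentLaw x y = segmentLaw y x := by
  have h : MeasurePreserving (fun u : ℝ => 1 - u) (volume.restrict (Set.Icc (0 : ℝ) 1))
      (volume.restrict (Set.Icc (0 : ℝ) 1)) := by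
    have h1 := (Measure.measurePreserving_sub_left (volume : Measure ℝ) 1).restrict_preimage
      (measurableSet_Icc (a := (0 : ℝ)) (b := 1))
    have h2 : (fun u : ℝ => 1 - u) ⁻¹' Set.Icc 0 1 = Set.Icc 0 1 := by
      ext u
      simp only [Set.mem_preimage, Set.mem_Icc]
      constructor <;> rintro ⟨h, h'⟩ <;> constructor <;> linarith
    rwa [h2] at h1
  unfold segmentLaw
  conv_rhs => rw [← h.map_eq]
  rw [Measure.map_map (by fun_prop) (by fun_prop)]
  congr 1
  ext u
  simp only [Function.comp, smul_eq_mul]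
  ring

/-- A weight proportional to the length means constant density `c`. This form remains valid for a
degenerate segment, where both sides vanish. -/
lemma smul_segmentLaw {x y c : ℝ} (hxy : x ≤ y) (hc : 0 ≤ c) :
    ENNReal.ofReal (c * (y - x)) • segmentLaw x y
      = ENNReal.ofReal c • volume.restrict (Set.Ioc x y) := by
  rcases hxy.eq_or_lt with rfl | hlt
  · simp
  have hd : 0 < y - x := sub_pos.2 hlt
  have hmap : ENNReal.ofReal (y - x) • (volume : Measure ℝ).map (fun u => x + u • (y - x))
      = volume := by
    have h1 := Real.smul_map_volume_mul_right hd.ne'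
    rw [abs_of_pos hd] at h1
    have h2 : (volume : Measure ℝ).map (fun u => x + u • (y - x))
        = ((volume : Measure ℝ).map (· * (y - x))).map (fun u => x + u) := by
      rw [Measure.map_map (by fun_prop) (by fun_prop)]
      rfl
    rw [h2, ← Measure.map_smul, h1, map_add_left_eq_self]
  have hpre : (fun u : ℝ => x + u • (y - x)) ⁻¹' Set.Ioc x y = Set.Ioc 0 1 := by
    ext u
    simp only [Set.mem_preimage, Set.mem_Ioc, smul_eq_mul]
    constructor
    · rintro ⟨h, h'⟩
      exact ⟨by by_contra hu; nlinarith, by by_contra hu; nlinarith⟩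
    · rintro ⟨h, h'⟩
      exact ⟨by nlinarith, by nlinarith⟩
  have hrest : segmentLaw x y
      = ((volume : Measure ℝ).map (fun u => x + u • (y - x))).restrict (Set.Ioc x y) := by
    rw [Measure.restrict_map (by fun_prop) measurableSet_Ioc, hpre,
      Measure.restrict_congr_set Ioc_ae_eq_Icc]
    rfl
  rw [hrest, ENNReal.ofReal_mul hc, mul_smul, ← Measure.restrict_smul, hmap]

lemma segmentLaw_self (x : ℝ) : segmentLaw x x = Measure.dirac x := by
  simp [segmentLaw, Measure.map_const]

lemma segmentLaw_zero {a : ℝ} (ha : 0 < a) : segmentLaw 0 a = unif a := by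
  have h := smul_segmentLaw ha.le (inv_nonneg.2 ha.le)
  rw [sub_zero, inv_mul_cancel₀ ha.ne', ENNReal.ofReal_one, one_smul] at h
  rw [h, unif, ProbabilityTheory.cond, Real.volume_Icc, sub_zero, ENNReal.ofReal_inv_of_pos ha,
    Measure.restrict_congr_set Ioc_ae_eq_Icc]

lemma smul_segmentLaw_add {a b c : ℝ} (hb : 0 ≤ b) (hba : b ≤ a) (hc : 0 ≤ c) :
    ENNReal.ofReal (c * b) • segmentLaw 0 b + ENNReal.ofReal (c * (a - b)) • segmentLaw b a
      = ENNReal.ofReal (c * a) • segmentLaw 0 a := by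
  have h1 := smul_segmentLaw hb hc
  have h2 := smul_segmentLaw hba hc
  have h3 := smul_segmentLaw (hb.trans hba) hc
  rw [sub_zero] at h1 h3
  rw [h1, h2, h3, ← smul_add, ← Measure.restrict_union (Set.Ioc_disjoint_Ioc_of_le le_rfl)
    measurableSet_Ioc, Set.Ioc_union_Ioc_eq_Ioc hb hba]

lemma isProbabilityMeasure_unif {a : ℝ} (ha : 0 < a) : IsProbabilityMeasure (unif a) := by
  refine ProbabilityTheory.cond_isProbabilityMeasure_of_finite ?_ ?_ <;> simp [ha]

lemma isProbabilityMeasure_zeroUnifMixture {p a : ℝ} (hp : 0 ≤ p) (hp1 : p ≤ 1) (ha : 0 < a) :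
    IsProbabilityMeasure (zeroUnifMixture p a) := by
  have := isProbabilityMeasure_unif ha
  constructor
  simp [zeroUnifMixture, ← ENNReal.ofReal_add (sub_nonneg.2 hp1) hp]

lemma zeroUnifMixture_zero (a : ℝ) : zeroUnifMixture 0 a = Measure.dirac 0 := by
  simp [zeroUnifMixture]

lemma zeroUnifMixture_one (a : ℝ) : zeroUnifMixture 1 a = unif a := by
  simp [zeroUnifMixture]

/-! ### Three distributions with constant sum -/

/-- Six pieces of uniform distributions which refill `[0, a]` evenly. -/
lemma sum_segmentLaw_eq_zeroUnifMixture {a b b' c c' w w' e f f' r r' : ℝ} (ha : 0 < a)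
    (hb : 0 ≤ b) (hba : b ≤ a) (hb' : 0 ≤ b') (hba' : b' ≤ a) (hc : 0 ≤ c) (hc' : 0 ≤ c')
    (hw : 0 ≤ w) (hw' : 0 ≤ w')
    (hf : 0 ≤ f) (hf' : 0 ≤ f') (hr : 0 ≤ r) (hr' : 0 ≤ r')
    (h : w + f = c * (a - b)) (h' : w' + f' = c' * (a - b'))
    (hsum : c * b + w + r + r' + c' * b' + w' + e + f' + f = 1) :
    ENNReal.ofReal w • segmentLaw b a + ENNReal.ofReal (c * b) • segmentLaw 0 b
      + ENNReal.ofReal r • segmentLaw 0 a + ENNReal.ofReal r' • segmentLaw 0 a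
      + ENNReal.ofReal (c' * b') • segmentLaw 0 b' + ENNReal.ofReal w' • segmentLaw b' a
      + ENNReal.ofReal e • segmentLaw 0 0 + ENNReal.ofReal f' • segmentLaw b' a
      + ENNReal.ofReal f • segmentLaw b a = zeroUnifMixture (1 - e) a := by
  -- By `h`, the pieces on `[0, b]` and `[b, a]` have the same density `c`, so they merge into a
  -- uniform piece on `[0, a]`; likewise for `b'` and `c'`.
  have e1 := smul_segmentLaw_add hb hba hc
  have e2 := smul_segmentLaw_add hb' hba' hc'
  rw [← h, ENNReal.ofReal_add hw hf, add_smul] at e1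
  rw [← h', ENNReal.ofReal_add hw' hf', add_smul] at e2
  have hp : 1 - e = c * a + r + r' + c' * a := by linarith
  rw [zeroUnifMixture, sub_sub_cancel, hp, ENNReal.ofReal_add (by positivity) (by positivity),
    ENNReal.ofReal_add (by positivity) (by positivity),
    ENNReal.ofReal_add (by positivity) (by positivity), add_smul, add_smul, add_smul,
    ← segmentLaw_zero ha, ← segmentLaw_self, ← e1, ← e2]
  abel

/-- Cramer's rule. For `d > 0` the determinant expands into nonnegative terms plus `d ^ 3`, and the
numerators have nonnegative terms only. -/
lemma exists_cyclic_solution {b₁ b₂ b₃ d e₁ e₂ e₃ : ℝ} (hb₁ : 0 ≤ b₁) (hb₂ : 0 ≤ b₂)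
    (hb₃ : 0 ≤ b₃) (hd : 0 < d) (he₁ : 0 ≤ e₁) (he₂ : 0 ≤ e₂) (he₃ : 0 ≤ e₃) :
    ∃ x y z : ℝ, 0 ≤ x ∧ 0 ≤ y ∧ 0 ≤ z ∧ b₁ * x + e₃ = y * (b₃ + d) ∧
      b₂ * y + e₁ = z * (b₁ + d) ∧ b₃ * z + e₂ = x * (b₂ + d) := by
  have hD : 0 < (b₁ + d) * (b₂ + d) * (b₃ + d) - b₁ * b₂ * b₃ := by
    have h : (b₁ + d) * (b₂ + d) * (b₃ + d) - b₁ * b₂ * b₃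
      = d ^ 3 + d ^ 2 * (b₁ + b₂ + b₃) + d * (b₁ * b₂ + b₁ * b₃ + b₂ * b₃) := by ring
    rw [h]
    positivity
  obtain ⟨D, hD'⟩ : ∃ D, D = (b₁ + d) * (b₂ + d) * (b₃ + d) - b₁ * b₂ * b₃ := ⟨_, rfl⟩
  rw [← hD'] at hD
  refine ⟨(e₂ * (b₃ + d) * (b₁ + d) + e₁ * b₃ * (b₃ + d) + b₂ * b₃ * e₃) / D,
    (e₃ * (b₁ + d) * (b₂ + d) + e₂ * b₁ * (b₁ + d) + b₃ * b₁ * e₁) / D,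
    (e₁ * (b₂ + d) * (b₃ + d) + e₃ * b₂ * (b₂ + d) + b₁ * b₂ * e₂) / D,
    by positivity, by positivity, by positivity, ?_, ?_, ?_⟩ <;>
  · field_simp
    rw [hD']
    ring

/-- The weights for `exists_three_coupling`, with `eᵢ = 1 - pᵢ` the atoms at `0`. The six balance
equations state that in each coordinate the density is the same on both sides of a breakpoint `K -
aⱼ`; the last one states that the total mass is `1`. With `bᵢ = K - aᵢ` and `d = a₁ + a₂ + a₃ - 2 *
K`, one has `a₁ + a₂ - K = b₃ + d` and so on, so they form two cyclic systems. -/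
lemma exists_segment_weights {K a₁ a₂ a₃ e₁ e₂ e₃ : ℝ} (h₁ : 0 < a₁) (h₂ : 0 < a₂) (h₃ : 0 < a₃)
    (hK₁ : a₁ ≤ K) (hK₂ : a₂ ≤ K) (hK₃ : a₃ ≤ K) (he₁ : 0 ≤ e₁) (he₂ : 0 ≤ e₂) (he₃ : 0 ≤ e₃)
    (hsum : (1 - e₁) * a₁ + (1 - e₂) * a₂ + (1 - e₃) * a₃ = 2 * K) :
    ∃ x y z x' y' z' : ℝ, 0 ≤ x ∧ 0 ≤ y ∧ 0 ≤ z ∧ 0 ≤ x' ∧ 0 ≤ y' ∧ 0 ≤ z' ∧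
      (K - a₁) * x + e₃ = y * (a₁ + a₂ - K) ∧ (K - a₂) * y + e₁ = z * (a₂ + a₃ - K) ∧
      (K - a₃) * z + e₂ = x * (a₁ + a₃ - K) ∧ (K - a₁) * z' + e₂ = y' * (a₁ + a₃ - K) ∧
      (K - a₂) * x' + e₃ = z' * (a₁ + a₂ - K) ∧ (K - a₃) * y' + e₁ = x' * (a₂ + a₃ - K) ∧
      (K - a₁) * x + (K - a₂) * y + (K - a₃) * z + (K - a₂) * x' + (K - a₃) * y' + (K - a₁) * z'
        + e₁ + e₂ + e₃ = 1 := by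
  have hd : a₁ + a₂ + a₃ - 2 * K = e₁ * a₁ + e₂ * a₂ + e₃ * a₃ := by linarith
  have hd0 : 0 ≤ a₁ + a₂ + a₃ - 2 * K := by rw [hd]; positivity
  rcases hd0.eq_or_lt with hz | hpos
  -- If `d = 0`, there are no atoms and the cyclic systems are singular and homogeneous. One
  -- orientation suffices, normalized by `Q` to total mass `1`.
  · have k₁ : 0 ≤ e₁ * a₁ := by positivity
    have k₂ : 0 ≤ e₂ * a₂ := by positivity
    have k₃ : 0 ≤ e₃ * a₃ := by positivity
    have z₁ : e₁ = 0 := by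
      have : e₁ * a₁ = 0 := by linarith
      simpa [h₁.ne'] using this
    have z₂ : e₂ = 0 := by
      have : e₂ * a₂ = 0 := by linarith
      simpa [h₂.ne'] using this
    have z₃ : e₃ = 0 := by
      have : e₃ * a₃ = 0 := by linarith
      simpa [h₃.ne'] using this
    subst z₁ z₂ z₃
    have hb₁ := sub_nonneg.2 hK₁
    have hb₂ := sub_nonneg.2 hK₂
    have hb₃ := sub_nonneg.2 hK₃
    obtain ⟨Q, hQ⟩ : ∃ Q, Q = (K - a₁) * (K - a₂) + (K - a₁) * (K - a₃)
        + (K - a₂) * (K - a₃) := ⟨_, rfl⟩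
    have hQ2 : 2 * Q = a₁ * (K - a₁) + a₂ * (K - a₂) + a₃ * (K - a₃) := by
      linear_combination 2 * hQ + (3 * K - a₁ - a₂ - a₃) * hz
    have hQ0 : 0 < Q := by
      have m₁ : 0 ≤ a₁ * (K - a₁) := by positivity
      have m₂ : 0 ≤ a₂ * (K - a₂) := by positivity
      have m₃ : 0 ≤ a₃ * (K - a₃) := by positivity
      by_contra hn
      have n₁ : K - a₁ = 0 :=
        (mul_eq_zero.1 (show a₁ * (K - a₁) = 0 by linarith)).resolve_left h₁.ne'
      have n₂ : K - a₂ = 0 :=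
        (mul_eq_zero.1 (show a₂ * (K - a₂) = 0 by linarith)).resolve_left h₂.ne'
      have n₃ : K - a₃ = 0 :=
        (mul_eq_zero.1 (show a₃ * (K - a₃) = 0 by linarith)).resolve_left h₃.ne'
      linarith
    refine ⟨(K - a₃) / Q, (K - a₁) / Q, (K - a₂) / Q, 0, 0, 0, by positivity, by positivity,
      by positivity, le_rfl, le_rfl, le_rfl, ?_, ?_, ?_, by simp, by simp, by simp, ?_⟩
    · rw [show a₁ + a₂ - K = K - a₃ by linarith]
      ring
    · rw [show a₂ + a₃ - K = K - a₁ by linarith]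
      ring
    · rw [show a₁ + a₃ - K = K - a₂ by linarith]
      ring
    · field_simp
      rw [hQ]
      ring
  · obtain ⟨x, y, z, hx, hy, hz, q₁, q₂, q₃⟩ := exists_cyclic_solution (sub_nonneg.2 hK₁)
      (sub_nonneg.2 hK₂) (sub_nonneg.2 hK₃) hpos he₁ he₂ he₃
    -- The second system is the first with the indices `1` and `3` exchanged.
    obtain ⟨y', x', z', hy', hx', hz', q₁', q₂', q₃'⟩ := exists_cyclic_solution (sub_nonneg.2 hK₃)
      (sub_nonneg.2 hK₂) (sub_nonneg.2 hK₁) hpos he₃ he₂ he₁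
    refine ⟨x, y, z, x', y', z', hx, hy, hz, hx', hy', hz', by linarith, by linarith, by linarith,
      by linarith, by linarith, by linarith, ?_⟩
    -- The total mass `M` is forced by the means: coordinate `i` contributes `(M - eᵢ) * aᵢ / 2`,
    -- and these add up to `M * K`. Subtracting `hsum` gives `(M - 1) * d = 0`.
    apply mul_left_cancel₀ hpos.ne'
    linear_combination -hsum - (K - a₂) * q₁ - (K - a₃) * q₂ - (K - a₁) * q₃ - (K - a₃) * q₃'
      - (K - a₁) * q₂' - (K - a₂) * q₁'

/-- Three distributions `(1 - pᵢ) δ₀ + pᵢ Unif[0, aᵢ]` have a coupling with constant sum `K`, as soon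
as their means add up to `K` and `aᵢ ≤ K`. -/
lemma exists_three_coupling {K a₁ a₂ a₃ p₁ p₂ p₃ : ℝ} (h₁ : 0 < a₁) (h₂ : 0 < a₂) (h₃ : 0 < a₃)
    (hK₁ : a₁ ≤ K) (hK₂ : a₂ ≤ K) (hK₃ : a₃ ≤ K) (hp₁ : p₁ ≤ 1) (hp₂ : p₂ ≤ 1) (hp₃ : p₃ ≤ 1)
    (hsum : p₁ * a₁ + p₂ * a₂ + p₃ * a₃ = 2 * K) :
    ∃ ρ : Measure (ℝ × ℝ × ℝ), ρ.map (fun x => x.1) = zeroUnifMixture p₁ a₁ ∧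
      ρ.map (fun x => x.2.1) = zeroUnifMixture p₂ a₂ ∧
      ρ.map (fun x => x.2.2) = zeroUnifMixture p₃ a₃ ∧ ∀ᵐ x ∂ρ, x.1 + x.2.1 + x.2.2 = K := by
  obtain ⟨x, y, z, x', y', z', hx, hy, hz, hx', hy', hz', q₁, q₂, q₃, q₁', q₂', q₃', hM⟩ :=
    exists_segment_weights h₁ h₂ h₃ hK₁ hK₂ hK₃ (sub_nonneg.2 hp₁) (sub_nonneg.2 hp₂)
      (sub_nonneg.2 hp₃) (by linarith)
  have hb₁ := sub_nonneg.2 hK₁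
  have hb₂ := sub_nonneg.2 hK₂
  have hb₃ := sub_nonneg.2 hK₃
  have hpa : ∀ {p a : ℝ}, 0 < a → p ≤ 1 → p * a ≤ a := fun ha hp => by nlinarith
  have i₁ := hpa h₁ hp₁
  have i₂ := hpa h₂ hp₂
  have i₃ := hpa h₃ hp₃
  -- These are the vertices of the (possibly degenerate) hexagon `x₁ + x₂ + x₃ = K`, `0 ≤ xᵢ ≤ aᵢ`:
  -- one coordinate is maximal, another is `0`. The segments of `ρ` are the sides of the triangles
  -- `P₁P₂P₃` and `Q₁Q₂Q₃`, and the three edges of the hexagon on which a coordinate vanishes, which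
  -- produce the atoms.
  let P₁ : ℝ × ℝ × ℝ := (a₁, 0, K - a₁)
  let P₂ : ℝ × ℝ × ℝ := (K - a₂, a₂, 0)
  let P₃ : ℝ × ℝ × ℝ := (0, K - a₃, a₃)
  let Q₁ : ℝ × ℝ × ℝ := (a₁, K - a₁, 0)
  let Q₂ : ℝ × ℝ × ℝ := (0, a₂, K - a₂)
  let Q₃ : ℝ × ℝ × ℝ := (K - a₃, 0, a₃)
  let ρ : Measure (ℝ × ℝ × ℝ) :=
    ENNReal.ofReal ((K - a₁) * x) • segmentLaw P₁ P₂
    + ENNReal.ofReal ((K - a₂) * y) • segmentLaw P₂ P₃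
    + ENNReal.ofReal ((K - a₃) * z) • segmentLaw P₃ P₁
    + ENNReal.ofReal ((K - a₂) * x') • segmentLaw Q₁ Q₂
    + ENNReal.ofReal ((K - a₃) * y') • segmentLaw Q₂ Q₃
    + ENNReal.ofReal ((K - a₁) * z') • segmentLaw Q₃ Q₁
    + ENNReal.ofReal (1 - p₁) • segmentLaw Q₂ P₃
    + ENNReal.ofReal (1 - p₂) • segmentLaw P₁ Q₃
    + ENNReal.ofReal (1 - p₃) • segmentLaw Q₁ P₂
  have m₁ : ∀ P Q : ℝ × ℝ × ℝ, (segmentLaw P Q).map (fun x => x.1) = segmentLaw P.1 Q.1 := by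
    intro P Q
    rw [segmentLaw, Measure.map_map (by fun_prop) (by fun_prop)]
    rfl
  have m₂ : ∀ P Q : ℝ × ℝ × ℝ, (segmentLaw P Q).map (fun x => x.2.1)
      = segmentLaw P.2.1 Q.2.1 := by
    intro P Q
    rw [segmentLaw, Measure.map_map (by fun_prop) (by fun_prop)]
    rfl
  have m₃ : ∀ P Q : ℝ × ℝ × ℝ, (segmentLaw P Q).map (fun x => x.2.2)
      = segmentLaw P.2.2 Q.2.2 := by
    intro P Q
    rw [segmentLaw, Measure.map_map (by fun_prop) (by fun_prop)]
    rfl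
  have hKae : ∀ P Q : ℝ × ℝ × ℝ, P.1 + P.2.1 + P.2.2 = K → Q.1 + Q.2.1 + Q.2.2 = K →
      ∀ᵐ x ∂(segmentLaw P Q), x.1 + x.2.1 + x.2.2 = K := by
    intro P Q hP hQ
    rw [segmentLaw, ae_map_iff (by fun_prop)
      (measurableSet_eq_fun (by fun_prop) measurable_const)]
    refine Filter.Eventually.of_forall fun u => ?_
    simp only [Prod.fst_add, Prod.snd_add, Prod.smul_fst, Prod.smul_snd, Prod.fst_sub,
      Prod.snd_sub, smul_eq_mul]
    linear_combination (1 - u) * hP + u * hQ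
  have hm₂ : Measurable fun x : ℝ × ℝ × ℝ => x.2.1 := by fun_prop
  have hm₃ : Measurable fun x : ℝ × ℝ × ℝ => x.2.2 := by fun_prop
  refine ⟨ρ, ?_, ?_, ?_, ?_⟩
  · have h := sum_segmentLaw_eq_zeroUnifMixture (b := K - a₂) (b' := K - a₃) (c := y) (c' := y')
      (w := (K - a₁) * x) (f := 1 - p₃) (w' := (K - a₁) * z') (f' := 1 - p₂) (e := 1 - p₁)
      (r := (K - a₃) * z) (r' := (K - a₂) * x') h₁ hb₂ (by linarith) hb₃ (by linarith) hy hy'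
      (by positivity) (by positivity) (by linarith) (by linarith) (by positivity) (by positivity)
      (by linarith) (by linarith) (by linarith)
    rw [sub_sub_cancel] at h
    rw [← h]
    simp only [ρ, Measure.map_add _ _ measurable_fst, Measure.map_smul, m₁, P₁, P₂, P₃, Q₁, Q₂, Q₃]
    rw [segmentLaw_comm a₁ (K - a₂), segmentLaw_comm (K - a₂) 0, segmentLaw_comm a₁ 0,
      segmentLaw_comm a₁ (K - a₃), mul_comm y, mul_comm y']
  · have h := sum_segmentLaw_eq_zeroUnifMixture (b := K - a₃) (b' := K - a₁) (c := z) (c' := z')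
      (w := (K - a₂) * y) (f := 1 - p₁) (w' := (K - a₂) * x') (f' := 1 - p₃) (e := 1 - p₂)
      (r := (K - a₁) * x) (r' := (K - a₃) * y') h₂ hb₃ (by linarith) hb₁ (by linarith) hz hz'
      (by positivity) (by positivity) (by linarith) (by linarith) (by positivity) (by positivity)
      (by linarith) (by linarith) (by linarith)
    rw [sub_sub_cancel] at h
    rw [← h]
    simp only [ρ, Measure.map_add _ _ hm₂, Measure.map_smul, m₂,
      P₁, P₂, P₃, Q₁, Q₂, Q₃]
    rw [segmentLaw_comm a₂ (K - a₃), segmentLaw_comm (K - a₃) 0, segmentLaw_comm a₂ 0,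
      mul_comm z, mul_comm z']
    abel
  · have h := sum_segmentLaw_eq_zeroUnifMixture (b := K - a₁) (b' := K - a₂) (c := x) (c' := x')
      (w := (K - a₃) * z) (f := 1 - p₂) (w' := (K - a₃) * y') (f' := 1 - p₁) (e := 1 - p₃)
      (r := (K - a₂) * y) (r' := (K - a₁) * z') h₃ hb₁ (by linarith) hb₂ (by linarith) hx hx'
      (by positivity) (by positivity) (by linarith) (by linarith) (by positivity) (by positivity)
      (by linarith) (by linarith) (by linarith)
    rw [sub_sub_cancel] at h
    rw [← h]
    simp only [ρ, Measure.map_add _ _ hm₃, Measure.map_smul, m₃,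
      P₁, P₂, P₃, Q₁, Q₂, Q₃]
    rw [segmentLaw_comm (K - a₁) 0, segmentLaw_comm a₃ (K - a₁), segmentLaw_comm a₃ 0,
      mul_comm x, mul_comm x']
    abel
  · simp only [ρ, ae_add_measure_iff]
    refine ⟨⟨⟨⟨⟨⟨⟨⟨?_, ?_⟩, ?_⟩, ?_⟩, ?_⟩, ?_⟩, ?_⟩, ?_⟩, ?_⟩ <;>
    exact Measure.ae_smul_measure (hKae _ _ (by simp [P₁, P₂, P₃, Q₁, Q₂, Q₃])
      (by simp [P₁, P₂, P₃, Q₁, Q₂, Q₃])) _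

/-! ### Two distributions whose sum has the same type -/

lemma mix_dirac_zeroUnifMixture {p q : ℝ} (a : ℝ) (hp : 0 ≤ p) (hp1 : p ≤ 1) (hq1 : q ≤ 1) :
    ENNReal.ofReal (1 - p) • Measure.dirac 0 + ENNReal.ofReal p • zeroUnifMixture q a
      = zeroUnifMixture (p * q) a := by
  have h : 1 - p * q = (1 - p) + p * (1 - q) := by ring
  have h1 := sub_nonneg.2 hp1
  have h2 := sub_nonneg.2 hq1
  rw [zeroUnifMixture, zeroUnifMixture, h, ENNReal.ofReal_add h1 (by positivity),
    ENNReal.ofReal_mul hp, ENNReal.ofReal_mul hp, smul_add, smul_smul, smul_smul, add_smul]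
  abel

lemma map_sub_unif {a : ℝ} (ha : 0 < a) : (unif a).map (fun x => a - x) = unif a := by
  conv_rhs => rw [← segmentLaw_zero ha, segmentLaw_comm]
  rw [← segmentLaw_zero ha, segmentLaw, segmentLaw, Measure.map_map (by fun_prop) (by fun_prop)]
  congr 1
  ext u
  simp only [Function.comp, smul_eq_mul]
  ring

/-- Coupling of two distributions such that the sum has the same type of distribution. -/
lemma exists_two_coupling {a₁ a₂ a p₁ p₂ p : ℝ} (h₁ : 0 < a₁) (h₂ : 0 < a₂) (ha₁ : a₁ ≤ a)
    (ha₂ : a₂ ≤ a) (hp : 0 < p) (hpp₁ : p₁ ≤ p) (hpp₂ : p₂ ≤ p)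
    (hp1 : p ≤ 1) (hsum : p₁ * a₁ + p₂ * a₂ = p * a) :
    ∃ ρ : Measure (ℝ × ℝ), ρ.map Prod.fst = zeroUnifMixture p₁ a₁ ∧
      ρ.map Prod.snd = zeroUnifMixture p₂ a₂ ∧
      ρ.map (fun x : ℝ × ℝ => x.1 + x.2) = zeroUnifMixture p a := by
  have ha : 0 < a := h₁.trans_le ha₁
  have q₁ : p₁ / p ≤ 1 := (div_le_one hp).2 hpp₁
  have q₂ : p₂ / p ≤ 1 := (div_le_one hp).2 hpp₂
  -- Conditionally on an event of probability `p`, the third variable is uniform on `[0, a]`, so the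
  -- sum of the first two, `a` minus the third, is uniform as well. Off the event both variables are
  -- `0`.
  obtain ⟨ρ, m₁, m₂, m₃, hρ⟩ := exists_three_coupling (p₁ := p₁ / p) (p₂ := p₂ / p) (p₃ := 1)
    (K := a) h₁ h₂ ha ha₁ ha₂ le_rfl q₁ q₂ le_rfl (by field_simp; linarith)
  have hsum' : ρ.map (fun x => x.1 + x.2.1) = zeroUnifMixture 1 a := by
    have hc : ρ.map (fun x => x.1 + x.2.1) = ρ.map (fun x => a - x.2.2) :=
      Measure.map_congr (hρ.mono fun x hx => by dsimp only; linarith)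
    have hcomp : ρ.map (fun x => a - x.2.2) = (ρ.map (fun x => x.2.2)).map (fun x => a - x) := by
      rw [Measure.map_map (by fun_prop) (by fun_prop)]
      rfl
    rw [hc, hcomp, m₃, zeroUnifMixture_one, map_sub_unif ha]
  have hmix : ∀ f : ℝ × ℝ → ℝ, Measurable f → f (0, 0) = 0 →
      (ENNReal.ofReal (1 - p) • Measure.dirac (0, 0)
        + ENNReal.ofReal p • ρ.map (fun x : ℝ × ℝ × ℝ => (x.1, x.2.1))).map f
      = ENNReal.ofReal (1 - p) • Measure.dirac 0
        + ENNReal.ofReal p • ρ.map (fun x => f (x.1, x.2.1)) := by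
    intro f hf h0
    rw [Measure.map_add _ _ hf, Measure.map_smul, Measure.map_smul, Measure.map_dirac' hf, h0,
      Measure.map_map hf (by fun_prop)]
    rfl
  refine ⟨ENNReal.ofReal (1 - p) • Measure.dirac (0, 0)
    + ENNReal.ofReal p • ρ.map (fun x => (x.1, x.2.1)), ?_, ?_, ?_⟩
  · rw [hmix _ measurable_fst rfl, m₁, mix_dirac_zeroUnifMixture _ hp.le hp1 q₁,
      mul_div_cancel₀ _ hp.ne']
  · rw [hmix _ measurable_snd rfl, m₂, mix_dirac_zeroUnifMixture _ hp.le hp1 q₂,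
      mul_div_cancel₀ _ hp.ne']
  · rw [hmix (fun x => x.1 + x.2) (by fun_prop) (by simp), hsum',
      mix_dirac_zeroUnifMixture _ hp.le hp1 le_rfl, mul_one]

/-! ### Gluing couplings along functions -/

section Gluing

variable {α β E F : Type*} [MeasurableSpace α] [MeasurableSpace β] [MeasurableSpace E]
  [MeasurableSpace F]

/-- Draw `x` from `π`, then the second variable from the conditional law of `ρ` given the first
coordinate `f x`. -/
lemma exists_glue_left [StandardBorelSpace β] [Nonempty β] {ρ : Measure (α × β)}
    [IsFiniteMeasure ρ] {π : Measure E} [IsFiniteMeasure π] {f : E → α} (hf : Measurable f)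
    (h : ρ.map Prod.fst = π.map f) :
    ∃ θ : Measure (E × β), IsFiniteMeasure θ ∧ θ.map Prod.fst = π ∧
      θ.map (fun x => (f x.1, x.2)) = ρ := by
  refine ⟨π.compProd (ρ.condKernel.comap f hf), inferInstance, Measure.fst_compProd _ _, ?_⟩
  conv_rhs => rw [← ρ.disintegrate ρ.condKernel]
  rw [Measure.fst, h]
  ext s hs
  rw [Measure.map_apply (by fun_prop) hs,
    Measure.compProd_apply ((by fun_prop : Measurable fun x : E × β => (f x.1, x.2)) hs),
    Measure.compProd_apply hs,
    lintegral_map (ProbabilityTheory.Kernel.measurable_kernel_prodMk_left hs) hf]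
  rfl

lemma exists_glue [StandardBorelSpace β] [Nonempty β] [StandardBorelSpace E] [Nonempty E]
    {ρ : Measure (α × β)} [IsFiniteMeasure ρ] {π : Measure E} [IsFiniteMeasure π] {η : Measure F}
    [IsFiniteMeasure η] {f : E → α} {g : F → β} (hf : Measurable f) (hg : Measurable g)
    (h₁ : ρ.map Prod.fst = π.map f) (h₂ : ρ.map Prod.snd = η.map g) :
    ∃ θ : Measure (E × F), θ.map Prod.fst = π ∧ θ.map Prod.snd = η ∧
      θ.map (fun x => (f x.1, g x.2)) = ρ := by
  obtain ⟨θ, hθ, hθ₁, hθ₂⟩ := exists_glue_left hf h₁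
  have hθs : (θ.map Prod.swap).map Prod.fst = η.map g := by
    rw [← h₂, ← hθ₂, Measure.map_map (by fun_prop) (by fun_prop),
      Measure.map_map (by fun_prop) (by fun_prop)]
    rfl
  obtain ⟨ξ, -, hξ₁, hξ₂⟩ := exists_glue_left (ρ := θ.map Prod.swap) hg hθs
  have hθξ : θ = ξ.map (fun x => (x.2, g x.1)) := by
    have h := congrArg (Measure.map Prod.swap) hξ₂
    rw [Measure.map_map (by fun_prop) (by fun_prop),
      Measure.map_map (by fun_prop) (by fun_prop), Prod.swap_swap_eq, Measure.map_id] at h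
    exact h.symm
  refine ⟨ξ.map Prod.swap, ?_, ?_, ?_⟩
  · rw [← hθ₁, hθξ, Measure.map_map (by fun_prop) (by fun_prop),
      Measure.map_map (by fun_prop) (by fun_prop)]
    rfl
  · rw [← hξ₁, Measure.map_map (by fun_prop) (by fun_prop)]
    rfl
  · rw [← hθ₂, hθξ, Measure.map_map (by fun_prop) (by fun_prop),
      Measure.map_map (by fun_prop) (by fun_prop)]
    rfl

end Gluing

/-- The distributions `m i`, `i ∈ s`, have a coupling whose sum has the distribution `ν`. -/
def HasSumLaw {n : ℕ} (m : Fin n → Measure ℝ) (s : Finset (Fin n)) (ν : Measure ℝ) : Prop :=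
  ∃ π : Measure (Allocation n), IsProbabilityMeasure π ∧ (∀ i ∈ s, π.map (fun x => x i) = m i) ∧
    π.map (fun x => ∑ i ∈ s, x i) = ν

/-- Only the joint law `ρ` of the two group sums has to be chosen; the allocations within each group
are restored by gluing. -/
lemma HasSumLaw.union {n : ℕ} {m : Fin n → Measure ℝ} {s t : Finset (Fin n)} {ν₁ ν₂ : Measure ℝ}
    (hs : HasSumLaw m s ν₁) (ht : HasSumLaw m t ν₂) (hst : Disjoint s t) {ρ : Measure (ℝ × ℝ)}
    (h₁ : ρ.map Prod.fst = ν₁) (h₂ : ρ.map Prod.snd = ν₂) :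
    HasSumLaw m (s ∪ t) (ρ.map (fun x => x.1 + x.2)) := by
  obtain ⟨π, hπ, hπm, hπs⟩ := hs
  obtain ⟨η, hη, hηm, hηs⟩ := ht
  have hρ : IsProbabilityMeasure ρ := by
    have : IsProbabilityMeasure (ρ.map Prod.fst) := by
      rw [h₁, ← hπs]
      exact Measure.isProbabilityMeasure_map (by fun_prop)
    exact Measure.isProbabilityMeasure_of_map Prod.fst
  obtain ⟨θ, hθ₁, hθ₂, hθ⟩ := exists_glue (ρ := ρ) (π := π) (η := η)
    (f := fun x : Allocation n => ∑ i ∈ s, x i) (g := fun x : Allocation n => ∑ i ∈ t, x i)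
    (by fun_prop) (by fun_prop) (h₁.trans hπs.symm) (h₂.trans hηs.symm)
  have hθp : IsProbabilityMeasure θ := by
    have : IsProbabilityMeasure (θ.map Prod.fst) := by rwa [hθ₁]
    exact Measure.isProbabilityMeasure_of_map Prod.fst
  have hmeas : Measurable
      (fun (p : Allocation n × Allocation n) (i : Fin n) => if i ∈ s then p.1 i else p.2 i) := by
    refine measurable_pi_lambda _ fun i => ?_
    split_ifs <;> fun_prop
  refine ⟨θ.map (fun p i => if i ∈ s then p.1 i else p.2 i),
    Measure.isProbabilityMeasure_map hmeas.aemeasurable, ?_, ?_⟩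
  · intro i hi
    rw [Measure.map_map (by fun_prop) hmeas]
    by_cases his : i ∈ s
    · rw [← hπm i his, ← hθ₁, Measure.map_map (by fun_prop) (by fun_prop)]
      congr 1
      ext p
      simp [his]
    · rw [← hηm i ((Finset.mem_union.1 hi).resolve_left his), ← hθ₂,
        Measure.map_map (by fun_prop) (by fun_prop)]
      congr 1
      ext p
      simp [his]
  · rw [← hθ, Measure.map_map (by fun_prop) hmeas, Measure.map_map (by fun_prop) (by fun_prop)]
    congr 1
    ext p
    simp only [Function.comp]
    rw [Finset.sum_union hst]
    congr 1
    · exact Finset.sum_congr rfl fun i hi => by simp [hi]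
    · exact Finset.sum_congr rfl fun i hi => by simp [Finset.disjoint_right.1 hst hi]

lemma hasSumLaw_empty {n : ℕ} (m : Fin n → Measure ℝ) : HasSumLaw m ∅ (Measure.dirac 0) :=
  ⟨Measure.dirac 0, inferInstance, by simp, by simp⟩

lemma hasSumLaw_singleton {n : ℕ} (m : Fin n → Measure ℝ) (i : Fin n) [IsProbabilityMeasure (m i)] :
    HasSumLaw m {i} (m i) := by
  have h : Measurable fun (r : ℝ) (_ : Fin n) => r := by fun_prop
  have h' : ((m i).map fun (r : ℝ) (_ : Fin n) => r).map (fun x => x i) = m i := by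
    rw [Measure.map_map (by fun_prop) h]
    exact Measure.map_id
  refine ⟨(m i).map fun r _ => r, Measure.isProbabilityMeasure_map h.aemeasurable, ?_, ?_⟩
  · simpa using h'
  · simpa using h'

/-! ### Joint mixability of all marginals -/

section JointMix

variable {n : ℕ} {a : Fin n → ℝ} {γ K : ℝ}

/-- Conservation of the mean in `hasSumLaw_of_sum_le`: the interval first grows up to length `K`
with uniform mass `γ`, then the mass grows instead. -/
lemma max_mul_min_eq (hγ : 0 ≤ γ) (hK : 0 < K) (A : ℝ) :
    max γ (γ * A / K) * min A K = γ * A := by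
  rcases le_total A K with h | h
  · rw [max_eq_left, min_eq_left h]
    rw [div_le_iff₀ hK]
    gcongr
  · rw [max_eq_right, min_eq_right h, div_mul_cancel₀ _ hK.ne']
    rw [le_div_iff₀ hK]
    gcongr

/-- As long as the total mean does not exceed `K / 2`, the distributions can be coupled such that the
sum has the same type of distribution, on an interval as long as possible within `[0, K]`. -/
lemma hasSumLaw_of_sum_le (hγ : 0 < γ) (hγ1 : γ ≤ 1) (ha : ∀ i, 0 < a i) (haK : ∀ i, a i ≤ K)
    {s : Finset (Fin n)} (hs : s.Nonempty) (hsK : γ * ∑ i ∈ s, a i ≤ K) :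
    HasSumLaw (fun i => zeroUnifMixture γ (a i)) s
      (zeroUnifMixture (max γ (γ * (∑ i ∈ s, a i) / K)) (min (∑ i ∈ s, a i) K)) := by
  have hsing : ∀ i, HasSumLaw (fun i => zeroUnifMixture γ (a i)) {i} (zeroUnifMixture γ (a i)) := by
    intro i
    have := isProbabilityMeasure_zeroUnifMixture hγ.le hγ1 (ha i)
    exact hasSumLaw_singleton _ i
  induction hs using Finset.Nonempty.cons_induction with
  | singleton i =>
    have hK : 0 < K := (ha i).trans_le (haK i)
    rw [Finset.sum_singleton, min_eq_left (haK i), max_eq_left]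
    · exact hsing i
    · rw [div_le_iff₀ hK]
      exact mul_le_mul_of_nonneg_left (haK i) hγ.le
  | cons i s hi hs ih =>
    have hK : 0 < K := (ha i).trans_le (haK i)
    rw [Finset.sum_cons] at hsK ⊢
    have hA : 0 < ∑ j ∈ s, a j := Finset.sum_pos (fun j _ => ha j) hs
    have hi0 := ha i
    obtain ⟨ρ, h₁, h₂, h₃⟩ := exists_two_coupling (a₁ := a i) (a₂ := min (∑ j ∈ s, a j) K)
      (a := min (a i + ∑ j ∈ s, a j) K) (p₁ := γ) (p₂ := max γ (γ * (∑ j ∈ s, a j) / K))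
      (p := max γ (γ * (a i + ∑ j ∈ s, a j) / K)) hi0 (lt_min hA hK)
      (le_min (by linarith) (haK i)) (min_le_min_right _ (by linarith))
      (hγ.trans_le (le_max_left _ _)) (le_max_left _ _)
      (max_le_max_left _ (by gcongr; linarith)) (max_le hγ1 ((div_le_one hK).2 hsK))
      (by rw [max_mul_min_eq hγ.le hK, max_mul_min_eq hγ.le hK]; ring)
    rw [← h₃, Finset.cons_eq_insert, Finset.insert_eq]
    exact (hsing i).union (ih (by nlinarith)) (Finset.disjoint_singleton_left.2 hi) h₁ h₂

lemma exists_zeroUnifMixture_hasSumLaw (hK : 0 < K) (hγ : 0 < γ) (hγ1 : γ ≤ 1) (ha : ∀ i, 0 < a i)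
    (haK : ∀ i, a i ≤ K) {s : Finset (Fin n)} (hsK : γ * ∑ i ∈ s, a i ≤ K) :
    ∃ p b, p ≤ 1 ∧ 0 < b ∧ b ≤ K ∧ p * b = γ * ∑ i ∈ s, a i ∧
      HasSumLaw (fun i => zeroUnifMixture γ (a i)) s (zeroUnifMixture p b) := by
  rcases s.eq_empty_or_nonempty with rfl | hs
  -- The sum over no battlefield is `δ₀`, seen as a mixture with uniform mass `0`; any length in
  -- `(0, K]` would do.
  · refine ⟨0, K, zero_le_one, hK, le_rfl, by simp, ?_⟩
    rw [zeroUnifMixture_zero]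
    exact hasSumLaw_empty _
  · exact ⟨_, _, max_le hγ1 ((div_le_one hK).2 hsK), lt_min (Finset.sum_pos (fun j _ => ha j) hs) hK,
      min_le_right _ _, max_mul_min_eq hγ.le hK _, hasSumLaw_of_sum_le hγ hγ1 ha haK hs hsK⟩

/-- Joint mixability: the distributions `(1 - γ) δ₀ + γ Unif[0, aᵢ]` have a coupling with constant sum
`K`, as soon as their means add up to `K` and `aᵢ ≤ K`. -/
theorem exists_coupling_sum_eq (hK : 0 < K) (hγ : 0 < γ) (hγ1 : γ ≤ 1) (ha : ∀ i, 0 < a i)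
    (haK : ∀ i, a i ≤ K) (hsum : γ * ∑ i, a i = 2 * K) :
    ∃ π : Measure (Allocation n), IsCoupling π (fun i => zeroUnifMixture γ (a i)) ∧
      ∀ᵐ x ∂π, ∑ i, x i = K := by
  classical
  -- Three groups, each with `γ * ∑ aᵢ ≤ K`: a set `s` of maximal size with this property, one
  -- further index `k`, and the rest. The rest qualifies because adding `k` to `s` overshoots `K`,
  -- while the total is `2 * K`.
  obtain ⟨s, hs, hmax⟩ := Finset.exists_max_image
    (Finset.univ.filter fun s : Finset (Fin n) => γ * ∑ i ∈ s, a i ≤ K) Finset.card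
    ⟨∅, by simp [hK.le]⟩
  simp only [Finset.mem_filter, Finset.mem_univ, true_and] at hs hmax
  obtain ⟨k, hk⟩ : ∃ k, k ∉ s := by
    by_contra! h
    rw [Finset.eq_univ_iff_forall.2 h] at hs
    linarith
  have hks : K < γ * (a k + ∑ i ∈ s, a i) := by
    by_contra! h
    have := hmax (insert k s) (by rwa [Finset.sum_insert hk])
    rw [Finset.card_insert_of_notMem hk] at this
    omega
  have htot : a k + ∑ i ∈ s, a i + ∑ i ∈ (insert k s)ᶜ, a i = ∑ i, a i := by
    rw [← Finset.sum_insert hk, Finset.sum_add_sum_compl]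
  have hak : γ * ∑ i ∈ {k}, a i ≤ K := by
    rw [Finset.sum_singleton]
    nlinarith [ha k, haK k]
  obtain ⟨p₁, b₁, hp₁, hb₁, hbK₁, hpb₁, l₁⟩ := exists_zeroUnifMixture_hasSumLaw hK hγ hγ1 ha haK hak
  obtain ⟨p₂, b₂, hp₂, hb₂, hbK₂, hpb₂, l₂⟩ := exists_zeroUnifMixture_hasSumLaw hK hγ hγ1 ha haK hs
  obtain ⟨p₃, b₃, hp₃, hb₃, hbK₃, hpb₃, l₃⟩ := exists_zeroUnifMixture_hasSumLaw (s := (insert k s)ᶜ)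
    hK hγ hγ1 ha haK (by nlinarith)
  rw [Finset.sum_singleton] at hpb₁
  obtain ⟨ρ, m₁, m₂, m₃, hρ⟩ := exists_three_coupling hb₁ hb₂ hb₃ hbK₁ hbK₂ hbK₃ hp₁ hp₂ hp₃
    (by rw [hpb₁, hpb₂, hpb₃, ← hsum, ← htot]; ring)
  have l₁₂ := l₁.union l₂ (Finset.disjoint_singleton_left.2 hk)
    (ρ := ρ.map fun x => (x.1, x.2.1))
    (by rw [← m₁, Measure.map_map (by fun_prop) (by fun_prop)]; rfl)
    (by rw [← m₂, Measure.map_map (by fun_prop) (by fun_prop)]; rfl)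
  rw [← Finset.insert_eq] at l₁₂
  have l := l₁₂.union l₃ disjoint_compl_right
    (ρ := ρ.map fun x => (x.1 + x.2.1, x.2.2))
    (by rw [Measure.map_map (by fun_prop) (by fun_prop),
          Measure.map_map (by fun_prop) (by fun_prop)]; rfl)
    (by rw [← m₃, Measure.map_map (by fun_prop) (by fun_prop)]; rfl)
  rw [Finset.union_compl] at l
  obtain ⟨π, -, hπ, hπs⟩ := l
  refine ⟨π, fun i => hπ i (Finset.mem_univ i), ?_⟩
  have hae : ∀ᵐ y ∂(π.map fun x => ∑ i, x i), y = K := by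
    rw [hπs, Measure.map_map (by fun_prop) (by fun_prop),
      ae_map_iff (by fun_prop) (measurableSet_eq_fun measurable_id' measurable_const)]
    exact hρ
  exact ae_of_ae_map (by fun_prop) hae

end JointMix

/-! ### Tails and means of the marginals -/

section Distributions

lemma le_measureReal_zeroUnifMixture_Ioi {p a t : ℝ} (hp : 0 ≤ p) (hp1 : p ≤ 1) (ha : 0 < a)
    (ht : 0 ≤ t) : p * (1 - t / a) ≤ (zeroUnifMixture p a).real (Set.Ioi t) := by
  have := isProbabilityMeasure_zeroUnifMixture hp hp1 ha
  refine (ENNReal.ofReal_le_iff_le_toReal (measure_ne_top _ _)).1 ?_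
  have hsub : Set.Ioc t a ⊆ Set.Icc 0 a ∩ Set.Ioi t := fun x hx =>
    ⟨⟨ht.trans hx.1.le, hx.2⟩, hx.1⟩
  have h1 : p * (1 - t / a) = p * (a⁻¹ * (a - t)) := by
    field_simp
  calc ENNReal.ofReal (p * (1 - t / a))
      = ENNReal.ofReal p * ((volume (Set.Icc 0 a))⁻¹ * volume (Set.Ioc t a)) := by
        rw [h1, ENNReal.ofReal_mul hp, ENNReal.ofReal_mul (inv_nonneg.2 ha.le),
          ENNReal.ofReal_inv_of_pos ha, Real.volume_Icc, Real.volume_Ioc, sub_zero]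
    _ ≤ ENNReal.ofReal p * unif a (Set.Ioi t) := by
        rw [unif, ProbabilityTheory.cond_apply measurableSet_Icc]
        gcongr
    _ ≤ zeroUnifMixture p a (Set.Ioi t) := by
        rw [zeroUnifMixture, Measure.add_apply, Measure.smul_apply, Measure.smul_apply,
          smul_eq_mul, smul_eq_mul]
        exact le_add_self

lemma integrable_unif {a : ℝ} (ha : 0 < a) : Integrable (fun x => x) (unif a) := by
  rw [← segmentLaw_zero ha, segmentLaw, integrable_map_measure (by fun_prop) (by fun_prop)]
  exact Continuous.integrableOn_Icc (by simp only [Function.comp_def]; fun_prop)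

lemma integral_unif {a : ℝ} (ha : 0 < a) : ∫ x, x ∂(unif a) = a / 2 := by
  rw [← segmentLaw_zero ha, segmentLaw, integral_map (by fun_prop) (by fun_prop),
    integral_Icc_eq_integral_Ioc, ← intervalIntegral.integral_of_le zero_le_one]
  simp only [smul_eq_mul, sub_zero, zero_add, intervalIntegral.integral_mul_const, integral_id]
  ring

lemma ae_nonneg_unif (a : ℝ) : ∀ᵐ x ∂(unif a), 0 ≤ x :=
  (ProbabilityTheory.ae_cond_mem measurableSet_Icc).mono fun _ hx => hx.1

lemma integrable_zeroUnifMixture (p : ℝ) {a : ℝ} (ha : 0 < a) :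
    Integrable (fun x => x) (zeroUnifMixture p a) :=
  ((integrable_dirac (by simp)).smul_measure ENNReal.ofReal_ne_top).add_measure
    ((integrable_unif ha).smul_measure ENNReal.ofReal_ne_top)

lemma integral_zeroUnifMixture {p a : ℝ} (hp : 0 ≤ p) (ha : 0 < a) :
    ∫ x, x ∂(zeroUnifMixture p a) = p * (a / 2) := by
  rw [zeroUnifMixture, integral_add_measure
    ((integrable_dirac (by simp)).smul_measure ENNReal.ofReal_ne_top)
    ((integrable_unif ha).smul_measure ENNReal.ofReal_ne_top), integral_smul_measure,
    integral_smul_measure, integral_dirac, integral_unif ha, ENNReal.toReal_ofReal hp]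
  simp

lemma ae_nonneg_zeroUnifMixture (p a : ℝ) : ∀ᵐ x ∂(zeroUnifMixture p a), 0 ≤ x := by
  refine ae_add_measure_iff.2 ⟨Measure.ae_smul_measure ?_ _,
    Measure.ae_smul_measure (ae_nonneg_unif a) _⟩
  rw [ae_dirac_iff measurableSet_Ici]

end Distributions

/-! ### The constant-sum reward and its lower bound -/

section Utility

variable {n : ℕ} {G : Game n} {τ : TieRule n}

lemma won_nonneg (τ : TieRule n) (P : Player) (i : Fin n) (x y : Allocation n) :
    0 ≤ won τ P i x y := by
  unfold won
  split_ifs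
  · exact zero_le_one
  · cases P
    · exact τ.share_nonneg i x y
    · exact sub_nonneg.2 (τ.share_le_one i y x)
  · exact le_rfl

lemma won_add_won (τ : TieRule n) (i : Fin n) (x y : Allocation n) :
    won τ .A i x y + won τ .B i y x = 1 := by
  unfold won
  rcases lt_trichotomy (x i) (y i) with h | h | h
  · simp [h, h.not_gt, h.ne]
  · simp [h, TieRule.shareOf]
  · simp [h, h.not_gt, h.ne]

lemma won_le_one (τ : TieRule n) (P : Player) (i : Fin n) (x y : Allocation n) :
    won τ P i x y ≤ 1 := by
  cases P
  · linarith [won_add_won τ i x y, won_nonneg τ .B i y x]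
  · linarith [won_add_won τ i y x, won_nonneg τ .A i y x]

lemma measurable_won (τ : TieRule n) (P : Player) (i : Fin n) :
    Measurable fun p : Allocation n × Allocation n => won τ P i p.1 p.2 := by
  have hA : Measurable fun p : Allocation n × Allocation n => won τ .A i p.1 p.2 := by
    unfold won
    exact Measurable.ite (measurableSet_lt (by fun_prop) (by fun_prop)) measurable_const
      (Measurable.ite (measurableSet_eq_fun (by fun_prop) (by fun_prop)) (τ.measurable_share i)
        measurable_const)
  cases P
  · exact hA
  · have h : (fun p : Allocation n × Allocation n => won τ .B i p.1 p.2)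
        = fun p => 1 - won τ .A i p.2 p.1 := by
      ext p
      linarith [won_add_won τ i p.2 p.1]
    rw [h]
    exact measurable_const.sub (hA.comp measurable_swap)

lemma integrable_won (τ : TieRule n) (P : Player) (i : Fin n)
    (μ : Measure (Allocation n × Allocation n)) [IsFiniteMeasure μ] :
    Integrable (fun p => won τ P i p.1 p.2) μ :=
  Integrable.of_bound (measurable_won τ P i).aestronglyMeasurable 1 <|
    Filter.Eventually.of_forall fun p => by
      rw [Real.norm_of_nonneg (won_nonneg ..)]
      exact won_le_one ..

lemma utility_eq_sum (G : Game n) (τ : TieRule n) (P : Player) (μ ν : Measure (Allocation n))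
    [IsFiniteMeasure μ] [IsFiniteMeasure ν] :
    utility G τ P μ ν = ∑ i, G.value P i * ∫ p, won τ P i p.1 p.2 ∂(μ.prod ν) := by
  rw [utility, integral_finsetSum _ fun i _ => (integrable_won τ P i _).const_mul _]
  simp only [integral_const_mul]

/-- For symmetric values the game has constant sum. -/
lemma utility_add_utility (hG : G.value .A = G.value .B) (P : Player)
    (μ ν : Measure (Allocation n)) [IsProbabilityMeasure μ] [IsProbabilityMeasure ν] :
    utility G τ P μ ν + utility G τ P.other ν μ = 1 := by
  have key : ∀ μ ν : Measure (Allocation n), IsProbabilityMeasure μ → IsProbabilityMeasure ν →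
      utility G τ .A μ ν + utility G τ .B ν μ = 1 := by
    intro μ ν hμ hν
    rw [utility_eq_sum, utility_eq_sum, ← Finset.sum_add_distrib, ← G.sum_value .B]
    refine Finset.sum_congr rfl fun i _ => ?_
    have h : ∫ p, won τ .A i p.1 p.2 ∂(μ.prod ν) + ∫ p, won τ .B i p.2 p.1 ∂(μ.prod ν) = 1 := by
      have hadd := integral_add (integrable_won τ .A i (μ.prod ν))
        (integrable_won τ .B i (ν.prod μ)).swap
      refine hadd.symm.trans ?_
      simp [won_add_won]
    rw [hG, ← mul_add, ← integral_prod_swap (fun p => won τ .B i p.1 p.2)]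
    simp only [Prod.fst_swap, Prod.snd_swap, h, mul_one]
  cases P
  · exact key μ ν inferInstance inferInstance
  · rw [add_comm]
    exact key ν μ inferInstance inferInstance

/-- For a fixed opposing allocation `y`, a strict win has probability at least `p * (1 - y i / b)`;
being affine in `y i`, this bound integrates to one in terms of the mean. It also covers `y i > b`,
where it is merely negative. -/
lemma le_integral_won {p b : ℝ} (hp : 0 ≤ p) (hp1 : p ≤ 1) (hb : 0 < b) (P : Player) (i : Fin n)
    {π ν : Measure (Allocation n)} [IsProbabilityMeasure π] [IsProbabilityMeasure ν]
    (hπ : π.map (fun x => x i) = zeroUnifMixture p b) (hν : ∀ᵐ y ∂ν, 0 ≤ y i)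
    (hint : Integrable (fun y : Allocation n => y i) ν) :
    p * (1 - (∫ y, y i ∂ν) / b) ≤ ∫ q, won τ P i q.1 q.2 ∂(π.prod ν) := by
  rw [integral_prod_symm _ (integrable_won τ P i _)]
  have hconst : p * (1 - (∫ y, y i ∂ν) / b) = ∫ y, p * (1 - y i / b) ∂ν := by
    rw [integral_const_mul, integral_sub (integrable_const _) (hint.div_const _),
      integral_div]
    simp
  rw [hconst]
  refine integral_mono_ae (((integrable_const _).sub (hint.div_const _)).const_mul _)
    (integrable_won τ P i _).integral_prod_right (hν.mono fun y hy => ?_)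
  refine (le_measureReal_zeroUnifMixture_Ioi hp hp1 hb hy).trans ?_
  rw [← hπ, map_measureReal_apply (by fun_prop) measurableSet_Ioi,
    ← integral_indicator_one ((measurable_pi_apply i) measurableSet_Ioi)]
  refine integral_mono_of_nonneg (Filter.Eventually.of_forall fun x =>
    Set.indicator_nonneg (fun _ _ => zero_le_one) x) ?_ (Filter.Eventually.of_forall fun x => ?_)
  · exact Integrable.of_bound ((measurable_won τ P i).comp
      (by fun_prop : Measurable fun x : Allocation n => (x, y))).aestronglyMeasurable 1 <|
      Filter.Eventually.of_forall fun x => by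
        simp only
        rw [Real.norm_of_nonneg (won_nonneg ..)]
        exact won_le_one ..
  · refine Set.indicator_le' (fun x hx => ?_) (fun x _ => won_nonneg τ P i x y) x
    simp only [Set.mem_preimage, Set.mem_Ioi] at hx
    simp [won, hx]

end Utility

/-! ### Optimality and the budget constraint -/

section Optimality

variable {n : ℕ} {G : Game n} {τ : TieRule n}

/-- Strategies which secure values that add up to the total value are optimal. -/
lemma isOptimal_of_secures (hG : G.value .A = G.value .B)
    {admissible : Player → Measure (Allocation n) → Prop}
    (hadm : ∀ P μ, admissible P μ → IsProbabilityMeasure μ) {V : Player → ℝ} {P : Player}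
    (hV : V P + V P.other = 1) {π η : Measure (Allocation n)} (hπ : admissible P π)
    (hη : admissible P.other η) (hπV : Secures G τ admissible P π (V P))
    (hηV : Secures G τ admissible P.other η (V P.other)) : IsOptimal G τ admissible P π := by
  refine ⟨hπ, fun μ hμ c hc ν hν => ?_⟩
  have := hadm _ _ hμ
  have := hadm _ _ hη
  have h₁ := hc η hη
  have h₂ := hηV μ (by cases P <;> exact hμ)
  have h₃ := utility_add_utility (τ := τ) hG P μ η
  have h₄ := hπV ν hν
  linarith

lemma BlottoAdmissible.lottoAdmissible {P : Player} {μ : Measure (Allocation n)}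
    (h : BlottoAdmissible G P μ) : LottoAdmissible G P μ := by
  obtain ⟨⟨hμ, h0⟩, hsum⟩ := h
  have hint : ∀ i, Integrable (fun x : Allocation n => x i) μ := by
    intro i
    refine Integrable.of_bound (measurable_pi_apply i).aestronglyMeasurable (G.budget P) ?_
    filter_upwards [h0, hsum] with x hx hs
    rw [Real.norm_of_nonneg (hx i)]
    exact (Finset.single_le_sum (fun j _ => hx j) (Finset.mem_univ i)).trans hs
  refine ⟨⟨hμ, h0⟩, hint, ?_⟩
  rw [← integral_finsetSum _ fun i _ => hint i]
  calc ∫ x, ∑ i, x i ∂μ ≤ ∫ _, G.budget P ∂μ :=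
        integral_mono_ae (integrable_finsetSum _ fun i _ => hint i) (integrable_const _) hsum
    _ = G.budget P := by simp

/-- The mass which the marginals of player `P` put on the uniform part. -/
noncomputable def uniformMass (G : Game n) (P : Player) : ℝ := G.budget P / G.budget .A

lemma uniformMass_pos (G : Game n) (P : Player) : 0 < uniformMass G P :=
  div_pos (G.budget_pos P) (G.budget_pos .A)

lemma uniformMass_le_one (G : Game n) (P : Player) : uniformMass G P ≤ 1 := by
  rw [uniformMass, div_le_one (G.budget_pos .A)]
  cases P
  · exact le_rfl
  · exact G.budget_le

lemma lottoMarginal_eq {γ lam : ℝ} (hG : G.value .A = G.value .B)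
    (hγ : γ = G.budget .B / G.budget .A) (hlam : lam = G.budget .B / (2 * G.budget .A ^ 2))
    (P : Player) :
    lottoMarginal G γ lam P
      = fun i => zeroUnifMixture (uniformMass G P) (2 * G.budget .A * G.value .B i) := by
  ext1 i
  have hA := G.budget_pos .A
  have hB := G.budget_pos .B
  have hv := G.value_pos .B i
  have hγ1 : γ ≤ G.value .A i / G.value .B i := by
    rw [hG, div_self hv.ne', hγ]
    exact uniformMass_le_one G .B
  have hlen : γ * G.value .B i / lam = 2 * G.budget .A * G.value .B i := by
    rw [hγ, hlam]
    field_simp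
  cases P
  · rw [lottoMarginal, if_pos hγ1, hlen, uniformMass, div_self hA.ne', zeroUnifMixture_one]
  · rw [lottoMarginal, if_pos hγ1, hlen, hG, mul_div_cancel_right₀ _ hv.ne', hγ, uniformMass]

lemma IsCoupling.isProbabilityMeasure {π : Measure (Allocation n)} {m : Fin n → Measure ℝ}
    (h : IsCoupling π m) (i : Fin n) [hm : IsProbabilityMeasure (m i)] :
    IsProbabilityMeasure π := by
  rw [← h i] at hm
  exact Measure.isProbabilityMeasure_of_map (fun x => x i)

variable {π : Measure (Allocation n)} {P : Player}

lemma support_length_pos (G : Game n) (i : Fin n) : 0 < 2 * G.budget .A * G.value .B i := by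
  have := G.budget_pos .A
  have := G.value_pos .B i
  positivity

lemma isMixedStrategy_of_isCoupling
    (h : IsCoupling π fun i => zeroUnifMixture (uniformMass G P) (2 * G.budget .A * G.value .B i)) :
    IsMixedStrategy π := by
  have hm := fun i => isProbabilityMeasure_zeroUnifMixture (uniformMass_pos G P).le
    (uniformMass_le_one G P) (support_length_pos G i)
  refine ⟨h.isProbabilityMeasure ⟨0, by have := G.two_le; omega⟩, ae_all_iff.2 fun i => ?_⟩
  have h0 := ae_nonneg_zeroUnifMixture (uniformMass G P) (2 * G.budget .A * G.value .B i)
  rw [← show π.map (fun x => x i) = zeroUnifMixture _ _ from h i] at h0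
  exact ae_of_ae_map (measurable_pi_apply i).aemeasurable h0

lemma lottoAdmissible_of_isCoupling
    (h : IsCoupling π fun i => zeroUnifMixture (uniformMass G P) (2 * G.budget .A * G.value .B i)) :
    LottoAdmissible G P π := by
  refine ⟨isMixedStrategy_of_isCoupling h, fun i => ?_, ?_⟩
  · have hi := integrable_zeroUnifMixture (uniformMass G P) (support_length_pos G i)
    rw [← show π.map (fun x => x i) = zeroUnifMixture _ _ from h i] at hi
    exact hi.comp_measurable (measurable_pi_apply i)
  · have hmean : ∀ i, ∫ x, x i ∂π = G.budget P * G.value .B i := by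
      intro i
      have hi := integral_zeroUnifMixture (uniformMass_pos G P).le (support_length_pos G i)
      have hA := (G.budget_pos .A).ne'
      rw [← show π.map (fun x => x i) = zeroUnifMixture _ _ from h i,
        integral_map (measurable_pi_apply i).aemeasurable (by fun_prop)] at hi
      rw [hi, uniformMass]
      field_simp
    simp only [hmean]
    rw [← Finset.mul_sum, G.sum_value, mul_one]

/-- The expected reward that the marginals of player `P` secure. -/
noncomputable def securedValue (G : Game n) (P : Player) : ℝ :=
  uniformMass G P * (1 - G.budget P.other / (2 * G.budget .A))

lemma securedValue_add_securedValue (G : Game n) (P : Player) :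
    securedValue G P + securedValue G P.other = 1 := by
  have hA := (G.budget_pos .A).ne'
  cases P <;>
  · simp only [securedValue, uniformMass, Player.other]
    field_simp
    ring

lemma securedValue_le_utility (hG : G.value .A = G.value .B)
    (h : IsCoupling π fun i => zeroUnifMixture (uniformMass G P) (2 * G.budget .A * G.value .B i))
    {ν : Measure (Allocation n)} (hν : LottoAdmissible G P.other ν) :
    securedValue G P ≤ utility G τ P π ν := by
  obtain ⟨⟨hνp, hν0⟩, hint, hsum⟩ := hν
  have := (isMixedStrategy_of_isCoupling h).1
  have hA := G.budget_pos .A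
  have hq := uniformMass_pos G P
  have hvP : G.value P = G.value .B := by
    cases P
    · exact hG
    · rfl
  rw [utility_eq_sum, hvP]
  calc securedValue G P
      ≤ uniformMass G P * (1 - (∑ i, ∫ y, y i ∂ν) / (2 * G.budget .A)) := by
        unfold securedValue
        gcongr
    _ = ∑ i, G.value .B i *
          (uniformMass G P * (1 - (∫ y, y i ∂ν) / (2 * G.budget .A * G.value .B i))) := by
        have hterm : ∀ i, G.value .B i *
            (uniformMass G P * (1 - (∫ y, y i ∂ν) / (2 * G.budget .A * G.value .B i)))
            = uniformMass G P * (G.value .B i - (∫ y, y i ∂ν) / (2 * G.budget .A)) := by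
          intro i
          have := (G.value_pos .B i).ne'
          field_simp
        simp only [hterm]
        rw [← Finset.mul_sum, Finset.sum_sub_distrib, G.sum_value, Finset.sum_div]
    _ ≤ _ := by
        gcongr with i _
        · exact (G.value_pos .B i).le
        · exact le_integral_won hq.le (uniformMass_le_one G P) (support_length_pos G i) P i (h i)
            (hν0.mono fun y hy => hy i) (hint i)

lemma isOptimal_lotto_of_isCoupling (hG : G.value .A = G.value .B)
    (h : IsCoupling π fun i => zeroUnifMixture (uniformMass G P) (2 * G.budget .A * G.value .B i)) :
    IsOptimal G τ (LottoAdmissible G) P π := by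
  have hm := fun i => isProbabilityMeasure_zeroUnifMixture (uniformMass_pos G P.other).le
    (uniformMass_le_one G P.other) (support_length_pos G i)
  -- The opponent's independent coupling serves as the certificate that no strategy of `P` secures
  -- more.
  have hη : IsCoupling (Measure.pi fun i => zeroUnifMixture (uniformMass G P.other)
      (2 * G.budget .A * G.value .B i))
      fun i => zeroUnifMixture (uniformMass G P.other) (2 * G.budget .A * G.value .B i) :=
    fun i => (measurePreserving_eval _ i).map_eq
  exact isOptimal_of_secures hG (fun _ _ hμ => hμ.1.1) (securedValue_add_securedValue G P)
    (lottoAdmissible_of_isCoupling h) (lottoAdmissible_of_isCoupling hη)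
    (fun _ hν => securedValue_le_utility hG h hν) (fun _ hν => securedValue_le_utility hG hη hν)

lemma exists_blottoAdmissible_coupling (hv : ∀ i, G.value .B i ≤ G.budget .B / (2 * G.budget .A))
    (P : Player) :
    ∃ π : Measure (Allocation n), IsCoupling π
        (fun i => zeroUnifMixture (uniformMass G P) (2 * G.budget .A * G.value .B i)) ∧
      BlottoAdmissible G P π := by
  have hA := G.budget_pos .A
  have hBP : G.budget .B ≤ G.budget P := by
    cases P
    · exact G.budget_le
    · exact le_rfl
  have hlen : ∀ i, 2 * G.budget .A * G.value .B i ≤ G.budget P := fun i => by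
    have := (le_div_iff₀ (by positivity)).1 (hv i)
    linarith
  obtain ⟨π, hπ, hsum⟩ := exists_coupling_sum_eq (G.budget_pos P) (uniformMass_pos G P)
    (uniformMass_le_one G P) (support_length_pos G) hlen (by
      rw [← Finset.mul_sum, G.sum_value, uniformMass]
      field_simp)
  exact ⟨π, hπ, isMixedStrategy_of_isCoupling hπ, hsum.mono fun _ hx => hx.le⟩

/-- Almost surely no battlefield receives more than `T_B`, whereas the marginal charges every
neighbourhood of `2 T_A v_i` from the left. -/
lemma value_le_of_blottoAdmissible
    (h : IsCoupling π
      fun i => zeroUnifMixture (uniformMass G .B) (2 * G.budget .A * G.value .B i))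
    (hπ : BlottoAdmissible G .B π) (i : Fin n) :
    G.value .B i ≤ G.budget .B / (2 * G.budget .A) := by
  have hA := G.budget_pos .A
  have hlen := support_length_pos G i
  have htail := le_measureReal_zeroUnifMixture_Ioi (uniformMass_pos G .B).le
    (uniformMass_le_one G .B) hlen (G.budget_pos .B).le
  have hzero : π.real ((fun x : Allocation n => x i) ⁻¹' Set.Ioi (G.budget .B)) = 0 := by
    rw [measureReal_def, ENNReal.toReal_eq_zero_iff]
    left
    rw [measure_eq_zero_iff_ae_notMem]
    filter_upwards [hπ.1.2, hπ.2] with x hx hs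
    simp only [Set.mem_preimage, Set.mem_Ioi, not_lt]
    exact (Finset.single_le_sum (fun j _ => hx j) (Finset.mem_univ i)).trans hs
  rw [← show π.map (fun x => x i) = zeroUnifMixture _ _ from h i,
    map_measureReal_apply (by fun_prop) measurableSet_Ioi, hzero] at htail
  have h1 : 1 ≤ G.budget .B / (2 * G.budget .A * G.value .B i) := by
    by_contra! hlt
    exact absurd htail (not_le.2 (mul_pos (uniformMass_pos G .B) (sub_pos.2 hlt)))
  rw [one_le_div hlen] at h1
  rw [le_div_iff₀ (by positivity)]
  linarith

end Optimality

end Blotto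

theorem mainTheorem2 {n : ℕ} (G : Blotto.Game n) (τ : Blotto.TieRule n)
    (v : Fin n → ℝ) (hA : G.value .A = v) (hB : G.value .B = v)
    (γ lam : ℝ) (hγ : γ = G.budget .B / G.budget .A)
    (hlam : lam = G.budget .B / (2 * G.budget .A ^ 2)) :
    (∀ (P : Blotto.Player) (π : Measure (Blotto.Allocation n)),
      Blotto.IsCoupling π (Blotto.lottoMarginal G γ lam P) →
        Blotto.IsOptimal G τ (Blotto.LottoAdmissible G) P π) ∧
    ((∀ P : Blotto.Player, ∃ π : Measure (Blotto.Allocation n),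
      Blotto.IsCoupling π (Blotto.lottoMarginal G γ lam P) ∧
        Blotto.IsOptimal G τ (Blotto.BlottoAdmissible G) P π) ↔
      ∀ i, v i ≤ G.budget .B / (2 * G.budget .A)) := by
  have hG : G.value .A = G.value .B := hA.trans hB.symm
  subst hB
  simp only [Blotto.lottoMarginal_eq hG hγ hlam]
  refine ⟨fun P π h => Blotto.isOptimal_lotto_of_isCoupling hG h, fun h i => ?_, fun hv P => ?_⟩
  · obtain ⟨π, hπ, hopt⟩ := h .B
    exact Blotto.value_le_of_blottoAdmissible hπ hopt.1 i
  · obtain ⟨π, hπ, hadm⟩ := Blotto.exists_blottoAdmissible_coupling hv P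
    obtain ⟨η, hη, hadm'⟩ := Blotto.exists_blottoAdmissible_coupling hv P.other
    exact ⟨π, hπ, Blotto.isOptimal_of_secures hG (fun _ _ hμ => hμ.1.1)
      (Blotto.securedValue_add_securedValue G P) hadm hadm'
      (fun _ hν => Blotto.securedValue_le_utility hG hπ hν.lottoAdmissible)
      (fun _ hν => Blotto.securedValue_le_utility hG hη hν.lottoAdmissible)⟩
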